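/- **Theorem (Strong damping in uniform topology).** Let $X$ be a (real or complex) Banach space and $\mathcal{B}(X)$ the algebra of bounded linear operators on $X$ with the operator norm. Let $\mathcal{K}$, with domain $\mathcal{D}(\mathcal{K})\subseteq X$, be the generator of a strongly continuous contraction semigroup $(e^{t\mathcal{K}})_{t\ge 0}$ on $X$ which satisfies, in operator norm, $$\lim_{\gamma\to\infty} e^{\gamma\mathcal{K}} = P$$ for some $P\in\mathcal{B}(X)$, and let $\mathcal{L}\in\mathcal{B}(X)$. Then, for every $\gamma>0$, the operator $\gamma\mathcal{K}+\mathcal{L}$ with domain $\mathcal{D}(\mathcal{K})$ is the generator of a unique strongly continuous semigroup $(e^{t(\gamma\mathcal{K}+\mathcal{L})})_{t\ge 0}$, and for every $t>0$ we have, in operator norm, $$\lim_{\gamma\to\infty} e^{t(\gamma\mathcal{K}+\mathcal{L})} = e^{tP\mathcal{L}P}P .$$ More precisely, for every $t>0$ there is a constant $C\ge 1$, independent of $\gamma$, such that for all $\gamma\ge 2$ $$\left\| e^{t(\gamma\mathcal{K}+\mathcal{L})} - e^{tP\mathcal{L}P}P\right\| \le \frac{C\log(\gamma)}{\gamma}.$$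 -/

import Mathlib

open Filter Topology
open scoped NNReal

/-- A strongly continuous one-parameter semigroup of bounded linear operators on `X`. -/
structure IsStronglyContinuousSemigroup {𝕜 X : Type*} [RCLike 𝕜] [NormedAddCommGroup X]
    [NormedSpace 𝕜 X] (T : ℝ≥0 → X →L[𝕜] X) : Prop where
  map_zero : T 0 = 1
  map_add : ∀ s t : ℝ≥0, T (s + t) = T s * T t
  strongly_continuous : ∀ x : X, Continuous fun t : ℝ≥0 => T t x

/-- The (generally unbounded) operator `A` with domain `A.domain` is the infinitesimal generator
of the strongly continuous semigroup `T`: a vector `x` lies in the domain of `A` and satisfies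
`A x = y` exactly when `(T t x - x) / t` tends to `y` as `t ↓ 0`. In this case `T t` is the
operator written `e ^ (t A)`. -/
structure GeneratesSemigroup {𝕜 X : Type*} [RCLike 𝕜] [NormedAddCommGroup X]
    [NormedSpace 𝕜 X] (A : X →ₗ.[𝕜] X) (T : ℝ≥0 → X →L[𝕜] X) : Prop where
  isSemigroup : IsStronglyContinuousSemigroup T
  mem_graph_iff : ∀ x y : X, (x, y) ∈ A.graph ↔
    Tendsto (fun t : ℝ≥0 => ((t : ℝ) : 𝕜)⁻¹ • (T t x - x)) (𝓝[>] 0) (𝓝 y)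

/-- The operator `γ K + L`, with the same domain as `K`. -/
noncomputable def dampedGenerator {𝕜 X : Type*} [RCLike 𝕜] [NormedAddCommGroup X]
    [NormedSpace 𝕜 X] (K : X →ₗ.[𝕜] X) (L : X →L[𝕜] X) (γ : ℝ) : X →ₗ.[𝕜] X :=
  (L : X →ₗ[𝕜] X) +ᵥ ((γ : 𝕜) • K)

/-!
Let `Q = 1 - P` and `ℓ = ‖L‖`.

*Existence.* A bounded perturbation `L` of the generator of a contraction semigroup `T` is handled
through the Volterra equation `S t x = T t x + ∫₀ᵗ T (t - s) L (S s x) ds`. After rescaling by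
`exp (-ω t)` with `ω = 2 ℓ + 1`, the integral operator has norm at most `1 / 2` on bounded continuous
functions, so the equation is solved by inverting `1 - V`; uniqueness of the solution gives the
semigroup law, and differentiating the equation at `0` identifies the generator
(`exists_semigroup_of_contraction`, `GeneratesSemigroup.of_volterra`). The bound
`‖S t‖ ≤ 2 exp ((2 ℓ + 1) t)` does not depend on `T`, hence is uniform in `γ`.

*One formula for the rest.* If `u' = B u + v` with `B` the generator of `S`, then
`u t - S t (u 0) = ∫₀ᵗ S (t - s) (v s) ds` (`GeneratesSemigroup.sub_eq_integral`). It is used three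
times.
* With `u` an orbit of another semigroup generated by `B` and `v = 0`, it gives uniqueness.
* With `u s = E (γ s) Q x` and `v = -L u`, it bounds `S t Q`: since `‖E t - P‖` decays exponentially,
  `‖S t Q‖ ≤ M exp (-a γ t) + c / γ` (`norm_damped_apply_sub_le`).
* With `u s = exp (s P L P) P x`, which stays in the range of `P`, where `K` vanishes, one has
  `v = -Q L u`. So `exp (t P L P) P - S t P` is an integral of `S (t - s) Q`, whose norm is
  `O(1 / γ)` by the previous bound (`norm_exp_apply_sub_damped_le`).

Adding up, the error at a fixed positive time is `O(1 / γ)`, which is stronger than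
`O(log γ / γ)` for `γ ≥ 2`.
-/

/-! ### Semigroups, generators and variation of constants -/

section Semigroup

open Set MeasureTheory intervalIntegral

variable {𝕜 X : Type*} [RCLike 𝕜] [NormedAddCommGroup X] [NormedSpace 𝕜 X]

/-- An exponentially bounded, strongly continuous family is jointly continuous. -/
theorem continuous_uncurry_of_norm_le {T : ℝ≥0 → X →L[𝕜] X}
    (hT : ∀ x, Continuous fun t => T t x) {N ω : ℝ}
    (hb : ∀ t : ℝ≥0, ‖T t‖ ≤ N * Real.exp (ω * t)) :
    Continuous fun p : ℝ≥0 × X => T p.1 p.2 := by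
  refine continuous_iff_continuousAt.2 fun ⟨t₀, x₀⟩ => ?_
  refine tendsto_iff_norm_sub_tendsto_zero.2 (squeeze_zero (fun _ => norm_nonneg _)
    (g := fun p : ℝ≥0 × X => N * Real.exp (ω * p.1) * ‖p.2 - x₀‖ + ‖T p.1 x₀ - T t₀ x₀‖) ?_ ?_)
  · rintro ⟨t, x⟩
    calc ‖T t x - T t₀ x₀‖ = ‖T t (x - x₀) + (T t x₀ - T t₀ x₀)‖ := by
          rw [map_sub]; congr 1; abel
      _ ≤ _ := (norm_add_le _ _).trans
        (add_le_add_left ((T t).le_of_opNorm_le (hb t) _) _)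
  · have h1 : Continuous fun p : ℝ≥0 × X => T p.1 x₀ := (hT x₀).comp continuous_fst
    refine Continuous.tendsto' (by fun_prop) _ _ (by simp)

theorem GeneratesSemigroup.apply_mem_graph {A : X →ₗ.[𝕜] X} {T : ℝ≥0 → X →L[𝕜] X}
    (h : GeneratesSemigroup A T) {x y : X} (hxy : (x, y) ∈ A.graph) (t : ℝ≥0) :
    (T t x, T t y) ∈ A.graph := by
  rw [h.mem_graph_iff] at hxy ⊢
  refine (((T t).continuous.tendsto y).comp hxy).congr fun s => ?_
  have : T t (T s x) = T s (T t x) := by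
    rw [← mul_apply_eq_comp, ← h.isSemigroup.map_add, add_comm, h.isSemigroup.map_add,
      mul_apply_eq_comp]
  simp [this]

variable [NormedSpace ℝ X] [IsScalarTower ℝ 𝕜 X]

/-- The limit defining the generator is a right derivative at `0` of the orbit, extended to `ℝ` by
its initial value. -/
theorem tendsto_inv_smul_iff_hasDerivWithinAt {T : ℝ≥0 → X →L[𝕜] X} (h0 : T 0 = 1) (x y : X) :
    Tendsto (fun t : ℝ≥0 => ((t : ℝ) : 𝕜)⁻¹ • (T t x - x)) (𝓝[>] 0) (𝓝 y) ↔
      HasDerivWithinAt (fun s : ℝ => T s.toNNReal x) y (Ioi 0) 0 := by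
  rw [hasDerivWithinAt_iff_tendsto_slope' self_notMem_Ioi]
  have key : ∀ t : ℝ≥0, ((t : ℝ) : 𝕜)⁻¹ • (T t x - x)
      = slope (fun s : ℝ => T s.toNNReal x) 0 t := by
    intro t
    rw [slope_def_module, RCLike.real_smul_eq_coe_smul (K := 𝕜)]
    simp [h0]
  simp_rw [key]
  constructor <;> intro h
  · have h1 : Tendsto Real.toNNReal (𝓝[>] 0) (𝓝[>] 0) := by
      refine tendsto_nhdsWithin_iff.2 ⟨?_, ?_⟩
      · exact (continuous_real_toNNReal.tendsto' 0 0 (by simp)).mono_left nhdsWithin_le_nhds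
      · filter_upwards [self_mem_nhdsWithin] with s hs using by simpa using hs
    refine (h.comp h1).congr' ?_
    filter_upwards [self_mem_nhdsWithin] with s hs
    simp [Real.coe_toNNReal s (le_of_lt hs)]
  · refine h.comp (tendsto_nhdsWithin_iff.2 ⟨?_, ?_⟩)
    · exact (NNReal.continuous_coe.tendsto' 0 0 (by simp)).mono_left nhdsWithin_le_nhds
    · filter_upwards [self_mem_nhdsWithin] with s hs using by simpa using hs

theorem GeneratesSemigroup.mem_graph_iff_hasDerivWithinAt {A : X →ₗ.[𝕜] X} {T : ℝ≥0 → X →L[𝕜] X}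
    (h : GeneratesSemigroup A T) (x y : X) :
    (x, y) ∈ A.graph ↔ HasDerivWithinAt (fun s : ℝ => T s.toNNReal x) y (Ioi 0) 0 :=
  (h.mem_graph_iff x y).trans (tendsto_inv_smul_iff_hasDerivWithinAt h.isSemigroup.map_zero x y)

/-- Orbits starting in the domain of the generator solve the abstract Cauchy problem. -/
theorem GeneratesSemigroup.hasDerivWithinAt_apply {A : X →ₗ.[𝕜] X} {T : ℝ≥0 → X →L[𝕜] X}
    (h : GeneratesSemigroup A T) {x y : X} (hxy : (x, y) ∈ A.graph) {s : ℝ} (hs : 0 ≤ s) :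
    HasDerivWithinAt (fun r : ℝ => T r.toNNReal x) (T s.toNNReal y) (Ioi s) s := by
  have h1 := (h.mem_graph_iff_hasDerivWithinAt _ _).1 (h.apply_mem_graph hxy s.toNNReal)
  have h2 : HasDerivWithinAt (fun r : ℝ => r - s) 1 (Ioi s) s :=
    ((hasDerivAt_id s).sub_const s).hasDerivWithinAt
  have h3 := HasDerivWithinAt.scomp_of_eq s h1 h2 (fun r (hr : s < r) => sub_pos.2 hr) (by simp)
  rw [one_smul] at h3
  have e : ∀ r : ℝ, s ≤ r → T r.toNNReal x = T (r - s).toNNReal (T s.toNNReal x) := by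
    intro r hr
    rw [← mul_apply_eq_comp, ← h.isSemigroup.map_add,
      ← Real.toNNReal_add (sub_nonneg.2 hr) hs, sub_add_cancel]
  exact h3.congr (fun r hr => e r (le_of_lt hr)) (e s le_rfl)

variable [CompleteSpace X]

/-- The averages `r⁻¹ • ∫₀ʳ T s x ds` lie in the domain and tend to `x` as `r ↓ 0`. -/
theorem GeneratesSemigroup.dense_domain {A : X →ₗ.[𝕜] X} {T : ℝ≥0 → X →L[𝕜] X}
    (h : GeneratesSemigroup A T) : Dense (A.domain : Set X) := by
  intro x
  set f : ℝ → X := fun s => T s.toNNReal x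
  have hf : Continuous f := (h.isSemigroup.strongly_continuous x).comp continuous_real_toNNReal
  set F : ℝ → X := fun r => ∫ s in (0 : ℝ)..r, f s
  have hF : ∀ r, HasDerivAt F (f r) r := fun r => hf.integral_hasStrictDerivAt 0 r |>.hasDerivAt
  have hmem : ∀ r : ℝ, 0 ≤ r → F r ∈ A.domain := by
    intro r hr
    have h1 : HasDerivWithinAt (fun s : ℝ => T s.toNNReal (F r)) (f r - f 0) (Ioi 0) 0 := by
      have h2 : HasDerivAt (fun s => F (s + r) - F s) (f r - f 0) 0 :=
        (HasDerivAt.comp_add_const (f := F) 0 r (by simpa using hF r)).sub (hF 0)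
      have e : ∀ s : ℝ, 0 ≤ s → T s.toNNReal (F r) = F (s + r) - F s := by
        intro s hs
        calc T s.toNNReal (F r) = ∫ q in (0 : ℝ)..r, T s.toNNReal (f q) := by
              have := ((T s.toNNReal).restrictScalars ℝ).intervalIntegral_comp_comm
                (hf.intervalIntegrable (μ := volume) 0 r)
              simpa using this.symm
          _ = ∫ q in (0 : ℝ)..r, f (s + q) := by
              refine intervalIntegral.integral_congr fun q hq => ?_
              rw [uIcc_of_le hr] at hq
              simp only [f]
              rw [Real.toNNReal_add hs hq.1, h.isSemigroup.map_add, mul_apply_eq_comp]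
          _ = ∫ q in s..(s + r), f q := by
              rw [intervalIntegral.integral_comp_add_left (f := f)]; simp
          _ = F (s + r) - F s := by
              rw [intervalIntegral.integral_interval_sub_left] <;>
                exact hf.intervalIntegrable _ _
      exact h2.hasDerivWithinAt.congr (fun s hs => e s (le_of_lt hs)) (e 0 le_rfl)
    exact LinearPMap.mem_domain_of_mem_graph ((h.mem_graph_iff_hasDerivWithinAt _ _).2 h1)
  have h1 := (hasDerivWithinAt_iff_tendsto_slope' self_notMem_Ioi).1
    ((hF 0).hasDerivWithinAt (s := Ioi 0))
  have h2 : f 0 = x := by simp [f, h.isSemigroup.map_zero]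
  rw [h2] at h1
  refine mem_closure_of_tendsto h1 ?_
  filter_upwards [self_mem_nhdsWithin] with r hr
  rw [slope_def_module, sub_zero, show F 0 = 0 by simp [F], sub_zero,
    RCLike.real_smul_eq_coe_smul (K := 𝕜)]
  exact A.domain.smul_mem _ (hmem r (le_of_lt hr))

/-- Variation of constants: if `u' = B u + v` for a generator `B` of `S`, then
`u t = S t (u 0) + ∫ S (t - s) (v s)`. Only the right derivative of `u` enters. -/
theorem GeneratesSemigroup.sub_eq_integral {B : X →ₗ.[𝕜] X} {S : ℝ≥0 → X →L[𝕜] X}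
    (h : GeneratesSemigroup B S) (hS : Continuous fun p : ℝ≥0 × X => S p.1 p.2)
    {u v : ℝ → X} (hu : Continuous u) (hv : Continuous v)
    (hd : ∀ s, 0 ≤ s → ∃ w, (u s, w) ∈ B.graph ∧ HasDerivWithinAt u (w + v s) (Ioi s) s)
    (t : ℝ≥0) :
    u t - S t (u 0) = ∫ s in (0 : ℝ)..t, S (t - s : ℝ).toNNReal (v s) := by
  have hc : ∀ {v : ℝ → X}, Continuous v →
      Continuous fun s : ℝ => S (t - s : ℝ).toNNReal (v s) := fun {v} hv =>
    hS.comp ((continuous_real_toNNReal.comp (by fun_prop : Continuous fun s : ℝ => (t : ℝ) - s)).prodMk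
      hv)
  rw [intervalIntegral.integral_eq_sub_of_hasDeriv_right_of_le t.coe_nonneg
    (f := fun s : ℝ => S (t - s : ℝ).toNNReal (u s)) (hc hu).continuousOn _
    ((hc hv).intervalIntegrable _ _)]
  · simp [h.isSemigroup.map_zero]
  rintro s ⟨hs0, hst⟩
  obtain ⟨w, hw, hdu⟩ := hd s hs0.le
  rw [hasDerivWithinAt_iff_tendsto_slope' self_notMem_Ioi]
  have h1 := (hasDerivWithinAt_iff_tendsto_slope' self_notMem_Ioi).1 hdu
  have h2 : Tendsto (fun r : ℝ => (r - s)⁻¹ • (S (r - s).toNNReal (u s) - u s)) (𝓝[>] s) (𝓝 w) := by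
    have h3 := (hasDerivWithinAt_iff_tendsto_slope' self_notMem_Ioi).1
      ((h.mem_graph_iff_hasDerivWithinAt _ _).1 hw)
    have h4 : Tendsto (fun r : ℝ => r - s) (𝓝[>] s) (𝓝[>] 0) := by
      refine tendsto_nhdsWithin_iff.2 ⟨?_, ?_⟩
      · exact (Continuous.tendsto' (by fun_prop) _ _ (by simp)).mono_left nhdsWithin_le_nhds
      · filter_upwards [self_mem_nhdsWithin] with r hr using sub_pos.2 (mem_Ioi.1 hr)
    refine (h3.comp h4).congr fun r => ?_
    simp [slope_def_module, h.isSemigroup.map_zero]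
  have h5 : Tendsto (fun r : ℝ => (t - r : ℝ).toNNReal) (𝓝[>] s) (𝓝 (t - s : ℝ).toNNReal) :=
    (Continuous.tendsto (continuous_real_toNNReal.comp (by fun_prop)) s).mono_left
      nhdsWithin_le_nhds
  -- The slope of `r ↦ S (t - r) (u r)` at `s` is `S (t - r)` applied to the difference of the slopes
  -- of `u` and of `S · (u s)`, because `S (t - s) = S (t - r) S (r - s)`.
  have h6 := (hS.tendsto _).comp (h5.prodMk_nhds (h1.sub h2))
  rw [add_sub_cancel_left] at h6
  refine h6.congr' ?_
  filter_upwards [Ioo_mem_nhdsGT hst] with r hr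
  have e : (t - s : ℝ).toNNReal = (t - r : ℝ).toNNReal + (r - s).toNNReal := by
    rw [← Real.toNNReal_add (sub_nonneg.2 hr.2.le) (sub_nonneg.2 hr.1.le)]; ring_nf
  simp only [Function.comp, slope_def_module, e, h.isSemigroup.map_add,
    mul_apply_eq_comp, map_sub, ContinuousLinearMap.map_smul_of_tower, ← smul_sub]
  congr 1
  abel

/-- A semigroup is determined by its generator. Joint continuity is asked of one of the two
semigroups only, so that no bound for the other one is needed. -/
theorem GeneratesSemigroup.eq {B : X →ₗ.[𝕜] X} {S T : ℝ≥0 → X →L[𝕜] X}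
    (h : GeneratesSemigroup B S) (hS : Continuous fun p : ℝ≥0 × X => S p.1 p.2)
    (hT : GeneratesSemigroup B T) : T = S := by
  ext t x
  refine congrFun (Continuous.ext_on h.dense_domain (T t).continuous (S t).continuous ?_) x
  intro y hy
  have hy' := B.mem_graph ⟨y, hy⟩
  have := h.sub_eq_integral hS (u := fun s : ℝ => T s.toNNReal y) (v := 0)
    ((hT.isSemigroup.strongly_continuous y).comp continuous_real_toNNReal) continuous_zero
    (fun s hs => ⟨_, hT.apply_mem_graph hy' _, by
      simpa using hT.hasDerivWithinAt_apply hy' hs⟩) t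
  simpa [hT.isSemigroup.map_zero, sub_eq_zero] using this

end Semigroup

/-! ### Bounded perturbations of contraction semigroups -/

section Volterra

open Set MeasureTheory intervalIntegral
open scoped BoundedContinuousFunction

variable {𝕜 X : Type*} [RCLike 𝕜] [NormedAddCommGroup X] [NormedSpace 𝕜 X]
theorem integral_exp_neg_mul_le {a : ℝ} (ha : 0 < a) (t : ℝ) :
    ∫ s in (0 : ℝ)..t, Real.exp (-a * s) ≤ a⁻¹ := by
  have h : ∀ s : ℝ, HasDerivAt (fun s => -a⁻¹ * Real.exp (-a * s)) (Real.exp (-a * s)) s := by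
    intro s
    have := (((hasDerivAt_id s).const_mul (-a)).exp).const_mul (-a⁻¹)
    refine this.congr_deriv ?_
    simp only [id, mul_one]
    field_simp
  rw [intervalIntegral.integral_eq_sub_of_hasDerivAt (fun s _ => h s)
    ((by fun_prop : Continuous fun s : ℝ => Real.exp (-a * s)).intervalIntegrable _ _)]
  have : 0 ≤ a⁻¹ * Real.exp (-a * t) := by positivity
  rw [mul_zero, Real.exp_zero]
  linarith

theorem IsStronglyContinuousSemigroup.exp_smul {T : ℝ≥0 → X →L[𝕜] X}
    (hsg : IsStronglyContinuousSemigroup T) (c : ℝ) :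
    IsStronglyContinuousSemigroup fun t => ((Real.exp (c * t) : ℝ) : 𝕜) • T t := by
  refine ⟨by simp [hsg.map_zero], fun s t => ?_, fun x => ?_⟩
  · rw [hsg.map_add, smul_mul_smul_comm, ← RCLike.ofReal_mul, ← Real.exp_add, NNReal.coe_add,
      mul_add]
  · have := hsg.strongly_continuous x
    simp only [smul_apply]
    fun_prop

theorem LinearPMap.mem_graph_vadd_iff (L : X →L[𝕜] X) (A : X →ₗ.[𝕜] X) (x y : X) :
    (x, y) ∈ ((L : X →ₗ[𝕜] X) +ᵥ A).graph ↔ (x, y - L x) ∈ A.graph := by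
  simp only [LinearPMap.mem_graph_iff']
  constructor <;> rintro ⟨z, hz⟩ <;> obtain ⟨h1, h2⟩ := Prod.mk.inj hz
  · refine ⟨z, Prod.ext h1 ?_⟩
    rw [← h1, ← h2, LinearPMap.vadd_apply]
    simp
  · refine ⟨z, Prod.ext h1 ?_⟩
    rw [LinearPMap.vadd_apply]
    simp [h2, h1]

theorem LinearPMap.mem_graph_smul_iff {c : 𝕜} (hc : c ≠ 0) (A : X →ₗ.[𝕜] X) (x y : X) :
    (x, y) ∈ (c • A).graph ↔ (x, c⁻¹ • y) ∈ A.graph := by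
  simp only [LinearPMap.mem_graph_iff']
  constructor <;> rintro ⟨z, hz⟩ <;> obtain ⟨h1, h2⟩ := Prod.mk.inj hz
  · refine ⟨z, Prod.ext h1 ?_⟩
    rw [← h2, LinearPMap.smul_apply, inv_smul_smul₀ hc]
  · refine ⟨z, Prod.ext h1 ?_⟩
    rw [LinearPMap.smul_apply, h2, smul_inv_smul₀ hc]

theorem continuous_conv_integrand {T : ℝ≥0 → X →L[𝕜] X}
    (hT : Continuous fun p : ℝ≥0 × X => T p.1 p.2) {v : ℝ → X} (hv : Continuous v) :
    Continuous fun p : ℝ × ℝ => T (p.1 - p.2).toNNReal (v p.2) :=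
  hT.comp ((continuous_real_toNNReal.comp (by fun_prop)).prodMk (hv.comp continuous_snd))

theorem continuous_conv_integrand_right {T : ℝ≥0 → X →L[𝕜] X}
    (hT : Continuous fun p : ℝ≥0 × X => T p.1 p.2) {v : ℝ → X} (hv : Continuous v) (t : ℝ) :
    Continuous fun s : ℝ => T (t - s).toNNReal (v s) :=
  (continuous_conv_integrand hT hv).comp (Continuous.prodMk_right t)

variable [NormedSpace ℝ X]

/-- Only the value at the corner enters: no differentiability in the parameter is needed. -/
theorem hasDerivAt_integral_diag {g : ℝ × ℝ → X} (hg : Continuous g) [CompleteSpace X] :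
    HasDerivAt (fun t => ∫ r in (0 : ℝ)..t, g (t, r)) (g (0, 0)) 0 := by
  rw [hasDerivAt_iff_isLittleO_nhds_zero, Asymptotics.isLittleO_iff]
  intro c hc
  obtain ⟨δ, hδ, h⟩ := Metric.continuousAt_iff.1 (hg.continuousAt (x := ((0 : ℝ), (0 : ℝ)))) c hc
  filter_upwards [Metric.ball_mem_nhds (0 : ℝ) hδ] with t ht
  have ht' : |t| < δ := by simpa using ht
  have h1 : (∫ r in (0 : ℝ)..t, g (t, r)) - t • g (0, 0) =
      ∫ r in (0 : ℝ)..t, (g (t, r) - g (0, 0)) := by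
    have hi : Continuous fun r => g (t, r) := hg.comp (Continuous.prodMk_right t)
    rw [intervalIntegral.integral_sub (hi.intervalIntegrable _ _) intervalIntegrable_const]
    simp
  rw [zero_add, intervalIntegral.integral_same, sub_zero, h1, Real.norm_eq_abs]
  have := intervalIntegral.norm_integral_le_of_norm_le_const (a := 0) (b := t) (C := c)
    (f := fun r => g (t, r) - g (0, 0)) fun r hr => by
      rw [← dist_eq_norm]
      refine (h ?_).le
      have hr' : |r| ≤ |t| := by
        rcases mem_uIoc.1 hr with h | h
        · rw [abs_of_pos h.1, abs_of_pos (h.1.trans_le h.2)]; exact h.2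
        · rw [abs_of_nonpos h.2, abs_of_neg (h.1.trans_le h.2)]; linarith [h.1]
      rw [Prod.dist_eq]
      simpa [ht'] using hr'.trans_lt ht'
  simpa using this

theorem continuous_conv {T : ℝ≥0 → X →L[𝕜] X}
    (hT : Continuous fun p : ℝ≥0 × X => T p.1 p.2) {v : ℝ → X} (hv : Continuous v) :
    Continuous fun t : ℝ => ∫ s in (0 : ℝ)..t, T (t - s).toNNReal (v s) :=
  intervalIntegral.continuous_parametric_intervalIntegral_of_continuous
    (continuous_conv_integrand hT hv) continuous_id

/-- For a semigroup decaying at rate `ω`, convolution gains the factor `1 / ω`. -/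
theorem norm_conv_le {T : ℝ≥0 → X →L[𝕜] X} {ω c : ℝ} (hω : 0 < ω)
    (hdec : ∀ t : ℝ≥0, ‖T t‖ ≤ Real.exp (-ω * t)) {v : ℝ → X}
    (hc : ∀ s, ‖v s‖ ≤ c) (t : ℝ≥0) :
    ‖∫ s in (0 : ℝ)..t, T (t - s : ℝ).toNNReal (v s)‖ ≤ ω⁻¹ * c := by
  have hc0 : 0 ≤ c := (norm_nonneg _).trans (hc 0)
  calc ‖∫ s in (0 : ℝ)..t, T (t - s : ℝ).toNNReal (v s)‖
      ≤ ∫ s in (0 : ℝ)..t, Real.exp (-ω * (t - s)) * c := by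
        refine intervalIntegral.norm_integral_le_of_norm_le t.coe_nonneg ?_
          ((by fun_prop : Continuous fun s : ℝ =>
            Real.exp (-ω * (t - s)) * c).intervalIntegrable _ _)
        refine Eventually.of_forall fun s hs => ((T _).le_opNorm _).trans ?_
        have := hdec (t - s : ℝ).toNNReal
        rw [Real.coe_toNNReal _ (sub_nonneg.2 hs.2)] at this
        exact mul_le_mul this (hc s) (norm_nonneg _) (Real.exp_nonneg _)
    _ = (∫ s in (0 : ℝ)..t, Real.exp (-ω * s)) * c := by
        rw [intervalIntegral.integral_mul_const,
          intervalIntegral.integral_comp_sub_left (fun s => Real.exp (-ω * s))]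
        simp
    _ ≤ _ := mul_le_mul_of_nonneg_right (integral_exp_neg_mul_le hω _) hc0

variable [IsScalarTower ℝ 𝕜 X]

/-- The Volterra operator `u ↦ ∫ T (t - s) L (u s) ds` on bounded continuous functions. -/
theorem exists_volterra {T : ℝ≥0 → X →L[𝕜] X}
    (hT : Continuous fun p : ℝ≥0 × X => T p.1 p.2) {ω : ℝ} (hω : 0 < ω)
    (hdec : ∀ t : ℝ≥0, ‖T t‖ ≤ Real.exp (-ω * t)) (L : X →L[𝕜] X) :
    ∃ V : (ℝ≥0 →ᵇ X) →L[𝕜] (ℝ≥0 →ᵇ X), ‖V‖ ≤ ω⁻¹ * ‖L‖ ∧ ∀ u (t : ℝ≥0),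
      V u t = ∫ s in (0 : ℝ)..t, T (t - s : ℝ).toNNReal (L (u s.toNNReal)) := by
  have hu : ∀ u : ℝ≥0 →ᵇ X, Continuous fun s : ℝ => L (u s.toNNReal) := fun u =>
    L.continuous.comp (u.continuous.comp continuous_real_toNNReal)
  have hb : ∀ (u : ℝ≥0 →ᵇ X) (t : ℝ≥0),
      ‖∫ s in (0 : ℝ)..t, T (t - s : ℝ).toNNReal (L (u s.toNNReal))‖ ≤ ω⁻¹ * ‖L‖ * ‖u‖ :=
    fun u t => by
      rw [mul_assoc]
      exact norm_conv_le hω hdec (fun s => (L.le_opNorm _).trans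
        (mul_le_mul_of_nonneg_left (u.norm_coe_le_norm _) (norm_nonneg _))) t
  have hi := fun (u : ℝ≥0 →ᵇ X) (t : ℝ≥0) =>
    (continuous_conv_integrand_right hT (hu u) t).intervalIntegrable (μ := volume) 0 t
  let V : (ℝ≥0 →ᵇ X) →ₗ[𝕜] (ℝ≥0 →ᵇ X) :=
    { toFun := fun u => BoundedContinuousFunction.ofNormedAddCommGroup
        (fun t : ℝ≥0 => ∫ s in (0 : ℝ)..t, T (t - s : ℝ).toNNReal (L (u s.toNNReal)))
        ((continuous_conv hT (hu u)).comp NNReal.continuous_coe) _ (hb u)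
      map_add' := fun u v => by
        ext t
        simp [intervalIntegral.integral_add (hi u t) (hi v t)]
      map_smul' := fun c u => by
        ext t
        simp }
  refine ⟨V.mkContinuous (ω⁻¹ * ‖L‖) fun u => ?_, V.mkContinuous_norm_le (by positivity) _,
    fun u t => rfl⟩
  exact (BoundedContinuousFunction.norm_le (by positivity)).2 (hb u)

theorem GeneratesSemigroup.rescale {A : X →ₗ.[𝕜] X} {T : ℝ≥0 → X →L[𝕜] X}
    (h : GeneratesSemigroup A T) {γ : ℝ≥0} (hγ : 0 < γ) :
    GeneratesSemigroup (((γ : ℝ) : 𝕜) • A) fun t => T (γ * t) := by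
  have hγ' : (0 : ℝ) < γ := hγ
  have hsg : IsStronglyContinuousSemigroup fun t => T (γ * t) :=
    ⟨by simp [h.isSemigroup.map_zero], fun s t => by rw [mul_add, h.isSemigroup.map_add],
      fun x => (h.isSemigroup.strongly_continuous x).comp (by fun_prop)⟩
  refine ⟨hsg, fun x y => ?_⟩
  rw [LinearPMap.mem_graph_smul_iff (by exact_mod_cast hγ'.ne'), h.mem_graph_iff_hasDerivWithinAt,
    tendsto_inv_smul_iff_hasDerivWithinAt hsg.map_zero, ← RCLike.ofReal_inv,
    ← RCLike.real_smul_eq_coe_smul]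
  have key : ∀ {f : ℝ → X} {z : X} {c : ℝ}, 0 < c → HasDerivWithinAt f z (Ioi 0) 0 →
      HasDerivWithinAt (fun s => f (c * s)) (c • z) (Ioi 0) 0 := by
    intro f z c hc hf
    have h1 : HasDerivWithinAt (fun s : ℝ => c * s) c (Ioi 0) 0 := by
      simpa using ((hasDerivAt_id (0 : ℝ)).const_mul c).hasDerivWithinAt
    exact HasDerivWithinAt.scomp_of_eq 0 hf h1 (fun s hs => mul_pos hc hs) (by simp)
  constructor <;> intro hd
  · have := key hγ' hd
    rw [smul_inv_smul₀ hγ'.ne'] at this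
    simpa [Real.toNNReal_mul hγ'.le] using this
  · have := key (inv_pos.2 hγ') hd
    simpa [Real.toNNReal_mul (inv_pos.2 hγ').le, Real.toNNReal_inv, hγ.ne'] using this

variable [CompleteSpace X]

/-- Splitting the convolution at time `s`. -/
theorem conv_add {T : ℝ≥0 → X →L[𝕜] X} (hsg : IsStronglyContinuousSemigroup T)
    (hT : Continuous fun p : ℝ≥0 × X => T p.1 p.2) {v : ℝ → X} (hv : Continuous v) (s t : ℝ≥0) :
    ∫ r in (0 : ℝ)..(s + t), T (s + t - r : ℝ).toNNReal (v r) =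
      T t (∫ r in (0 : ℝ)..s, T (s - r : ℝ).toNNReal (v r)) +
        ∫ r in (0 : ℝ)..t, T (t - r : ℝ).toNNReal (v (s + r)) := by
  have hi := fun (t a b : ℝ) =>
    (continuous_conv_integrand_right hT hv t).intervalIntegrable (μ := volume) a b
  rw [← intervalIntegral.integral_add_adjacent_intervals (hi (s + t) 0 s) (hi (s + t) s (s + t))]
  congr 1
  · have := ((T t).restrictScalars ℝ).intervalIntegral_comp_comm (hi s 0 s)
    simp only [ContinuousLinearMap.coe_restrictScalars'] at this
    rw [← this]
    refine intervalIntegral.integral_congr fun r hr => ?_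
    rw [uIcc_of_le s.coe_nonneg] at hr
    have e : (s + t - r : ℝ).toNNReal = t + (s - r : ℝ).toNNReal := by
      rw [add_sub_right_comm, add_comm, Real.toNNReal_add t.coe_nonneg (sub_nonneg.2 hr.2),
        Real.toNNReal_coe]
    simp only [e, hsg.map_add, mul_apply_eq_comp]
  · have := intervalIntegral.integral_comp_add_left (a := 0) (b := (t : ℝ))
      (fun r : ℝ => T (s + t - r : ℝ).toNNReal (v r)) (s : ℝ)
    simp only [add_zero, add_sub_add_left_eq_sub] at this
    exact this.symm

/-- The solution of the Volterra equation for a decaying semigroup: its orbits are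
`(1 - V)⁻¹` applied to the orbits of `T`, with `V` the Volterra operator. -/
theorem exists_semigroup_of_decay {T : ℝ≥0 → X →L[𝕜] X} (hsg : IsStronglyContinuousSemigroup T)
    (hT : Continuous fun p : ℝ≥0 × X => T p.1 p.2) {ω : ℝ} (hω : 0 < ω)
    (hdec : ∀ t : ℝ≥0, ‖T t‖ ≤ Real.exp (-ω * t)) (L : X →L[𝕜] X) (hL : ω⁻¹ * ‖L‖ ≤ 1 / 2) :
    ∃ S : ℝ≥0 → X →L[𝕜] X, IsStronglyContinuousSemigroup S ∧ (∀ t, ‖S t‖ ≤ 2) ∧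
      ∀ (t : ℝ≥0) x, S t x =
        T t x + ∫ s in (0 : ℝ)..t, T (t - s : ℝ).toNNReal (L (S s.toNNReal x)) := by
  obtain ⟨V, hVn, hV⟩ := exists_volterra hT hω hdec L
  have hV2 : ‖V‖ ≤ 1 / 2 := hVn.trans hL
  have hdec1 : ∀ t : ℝ≥0, ‖T t‖ ≤ 1 := fun t => (hdec t).trans
    (Real.exp_le_one_iff.2 (by have := mul_nonneg hω.le t.coe_nonneg; linarith))
  have hTx : ∀ x (t : ℝ≥0), ‖T t x‖ ≤ 1 * ‖x‖ := fun x t => (T t).le_of_opNorm_le (hdec1 t) x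
  let ι : X →L[𝕜] (ℝ≥0 →ᵇ X) := LinearMap.mkContinuous
    { toFun := fun x => BoundedContinuousFunction.ofNormedAddCommGroup (fun t : ℝ≥0 => T t x)
        (hsg.strongly_continuous x) _ (hTx x)
      map_add' := fun x y => by ext t; simp
      map_smul' := fun c x => by ext t; simp } 1
    (fun x => (BoundedContinuousFunction.norm_le (by positivity)).2 (hTx x))
  -- `R` is the inverse of `1 - V`, given by the Neumann series.
  let R : (ℝ≥0 →ᵇ X) →L[𝕜] (ℝ≥0 →ᵇ X) := ↑(Units.oneSub V (hV2.trans_lt (by norm_num)))⁻¹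
  have hR : ∀ f, R f = f + V (R f) := by
    intro f
    have h1 : (1 - V) * R = 1 := (Units.oneSub V (hV2.trans_lt (by norm_num))).mul_inv
    have h2 := congrArg (fun W => W f) h1
    simp only [mul_apply_eq_comp, sub_apply, one_apply_eq_self] at h2
    exact sub_eq_iff_eq_add.1 h2
  have hRn : ∀ f, ‖R f‖ ≤ 2 * ‖f‖ := by
    intro f
    have h1 : ‖R f‖ ≤ ‖f‖ + 1 / 2 * ‖R f‖ := by
      conv_lhs => rw [hR f]
      exact (norm_add_le _ _).trans (add_le_add_right (V.le_of_opNorm_le hV2 _) _)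
    linarith
  have huniq : ∀ f, f = V f → f = 0 := by
    intro f hf
    have h1 : ‖f‖ ≤ 1 / 2 * ‖f‖ := by
      conv_lhs => rw [hf]
      exact V.le_of_opNorm_le hV2 _
    exact norm_le_zero_iff.1 (by linarith)
  let S : ℝ≥0 → X →L[𝕜] X := fun t =>
    (BoundedContinuousFunction.evalCLM 𝕜 t) ∘L R ∘L ι
  have hSe : ∀ t x, S t x = R (ι x) t := fun t x => rfl
  have hSn : ∀ t, ‖S t‖ ≤ 2 := fun t => (S t).opNorm_le_bound (by norm_num) fun x =>
    calc ‖S t x‖ ≤ ‖R (ι x)‖ := (R (ι x)).norm_coe_le_norm t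
      _ ≤ 2 * ‖ι x‖ := hRn _
      _ ≤ 2 * ‖x‖ := by
        have : ‖ι x‖ ≤ 1 * ‖x‖ := ι.le_of_opNorm_le (LinearMap.mkContinuous_norm_le _ zero_le_one _) x
        linarith
  have hSc : ∀ x, Continuous fun t => S t x := fun x => (R (ι x)).continuous
  have heq : ∀ (t : ℝ≥0) x, S t x =
      T t x + ∫ s in (0 : ℝ)..t, T (t - s : ℝ).toNNReal (L (S s.toNNReal x)) := by
    intro t x
    rw [hSe, hR, BoundedContinuousFunction.add_apply, hV]
    rfl
  have hLS : ∀ x, Continuous fun r : ℝ => L (S r.toNNReal x) := fun x =>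
    L.continuous.comp ((hSc x).comp continuous_real_toNNReal)
  -- `S (s + ·) x` and `S · (S s x)` solve the same Volterra equation.
  have hadd : ∀ s t x, S (s + t) x = S t (S s x) := by
    intro s t x
    let u : ℝ≥0 →ᵇ X := BoundedContinuousFunction.ofNormedAddCommGroup
      (fun t : ℝ≥0 => S (s + t) x - S t (S s x))
      (((hSc x).comp (continuous_const.add continuous_id)).sub (hSc _)) (2 * ‖x‖ + 2 * ‖S s x‖)
      (fun t => (norm_sub_le _ _).trans (add_le_add ((S _).le_of_opNorm_le (hSn _) _)
        ((S _).le_of_opNorm_le (hSn _) _)))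
    have hu : u = V u := by
      ext t
      have h1 := conv_add hsg hT (hLS x) s t
      have h2 : ∀ r ∈ uIcc (0 : ℝ) t, T (t - r : ℝ).toNNReal (L (u r.toNNReal)) =
          T (t - r : ℝ).toNNReal (L (S (s + r : ℝ).toNNReal x)) -
            T (t - r : ℝ).toNNReal (L (S r.toNNReal (S s x))) := by
        intro r hr
        rw [uIcc_of_le t.coe_nonneg] at hr
        rw [Real.toNNReal_add s.coe_nonneg hr.1, Real.toNNReal_coe, ← map_sub, ← map_sub]
        rfl
      have hshift : Continuous fun r : ℝ => L (S (s + r : ℝ).toNNReal x) :=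
        (hLS x).comp (continuous_const.add continuous_id)
      rw [hV, intervalIntegral.integral_congr h2, intervalIntegral.integral_sub
        ((continuous_conv_integrand_right hT
          hshift t).intervalIntegrable _ _)
        ((continuous_conv_integrand_right hT (hLS _) t).intervalIntegrable _ _)]
      change S (s + t) x - S t (S s x) = _
      rw [heq (s + t), heq t (S s x), NNReal.coe_add, h1]
      conv_lhs => enter [2, 1]; rw [heq s x]
      rw [add_comm s t, hsg.map_add, mul_apply_eq_comp, map_add]
      abel
    have := congrArg (fun f : ℝ≥0 →ᵇ X => f t) (huniq u hu)
    exact sub_eq_zero.1 this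
  refine ⟨S, ⟨?_, fun s t => ?_, hSc⟩, hSn, heq⟩
  · ext x
    rw [heq]; simp [hsg.map_zero]
  · ext x
    rw [add_comm s t, hadd, mul_apply_eq_comp]

/-- A bounded perturbation `L` of a contraction semigroup `T`: the solution `S` of the Volterra
equation is a semigroup, with a bound that depends on `‖L‖` only. -/
theorem exists_semigroup_of_contraction {T : ℝ≥0 → X →L[𝕜] X}
    (hsg : IsStronglyContinuousSemigroup T) (hcontr : ∀ t, ‖T t‖ ≤ 1) (L : X →L[𝕜] X) :
    ∃ S : ℝ≥0 → X →L[𝕜] X, IsStronglyContinuousSemigroup S ∧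
      (∀ t, ‖S t‖ ≤ 2 * Real.exp ((2 * ‖L‖ + 1) * t)) ∧
      ∀ (t : ℝ≥0) x, S t x =
        T t x + ∫ s in (0 : ℝ)..t, T (t - s : ℝ).toNNReal (L (S s.toNNReal x)) := by
  set ω := 2 * ‖L‖ + 1 with hω
  have hω0 : 0 < ω := by positivity
  have hn : ∀ (a : ℝ) (A : X →L[𝕜] X), ‖((Real.exp a : ℝ) : 𝕜) • A‖ = Real.exp a * ‖A‖ := by
    intro a A
    rw [norm_smul, RCLike.norm_ofReal, Real.abs_exp]
  have hdec : ∀ t : ℝ≥0, ‖((Real.exp (-ω * t) : ℝ) : 𝕜) • T t‖ ≤ Real.exp (-ω * t) := fun t => by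
    rw [hn]
    exact mul_le_of_le_one_right (Real.exp_nonneg _) (hcontr t)
  have hsg' := hsg.exp_smul (-ω)
  obtain ⟨S, hS, hSn, heq⟩ := exists_semigroup_of_decay hsg'
    (continuous_uncurry_of_norm_le hsg'.strongly_continuous (N := 1) (ω := -ω)
      (by simpa using hdec)) hω0 hdec L (by
        rw [inv_mul_le_iff₀ hω0, hω]; linarith)
  refine ⟨_, hS.exp_smul ω, fun t => ?_, fun t x => ?_⟩
  · rw [hn, mul_comm]
    exact mul_le_mul_of_nonneg_right (hSn t) (Real.exp_nonneg _)
  · have hee : ∀ r : ℝ, ((Real.exp (ω * r) : ℝ) : 𝕜) * ((Real.exp (-ω * r) : ℝ) : 𝕜) = 1 := by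
      intro r
      rw [← RCLike.ofReal_mul, ← Real.exp_add]; simp
    rw [smul_apply, heq, smul_add, smul_apply, smul_smul, hee, one_smul,
      ← intervalIntegral.integral_smul]
    congr 1
    refine intervalIntegral.integral_congr fun s hs => ?_
    rw [uIcc_of_le t.coe_nonneg] at hs
    simp only [smul_apply, map_smul, smul_smul]
    rw [Real.coe_toNNReal _ (sub_nonneg.2 hs.2), Real.coe_toNNReal _ hs.1, ← RCLike.ofReal_mul,
      ← Real.exp_add]
    ring_nf

/-- The Volterra equation identifies the generator of `S` as `L + A`. -/
theorem GeneratesSemigroup.of_volterra {A : X →ₗ.[𝕜] X} {T S : ℝ≥0 → X →L[𝕜] X}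
    (h : GeneratesSemigroup A T) (hT : Continuous fun p : ℝ≥0 × X => T p.1 p.2) {L : X →L[𝕜] X}
    (hS : IsStronglyContinuousSemigroup S)
    (heq : ∀ (t : ℝ≥0) x, S t x =
        T t x + ∫ s in (0 : ℝ)..t, T (t - s : ℝ).toNNReal (L (S s.toNNReal x))) :
    GeneratesSemigroup ((L : X →ₗ[𝕜] X) +ᵥ A) S := by
  refine ⟨hS, fun x y => ?_⟩
  rw [LinearPMap.mem_graph_vadd_iff, h.mem_graph_iff_hasDerivWithinAt,
    tendsto_inv_smul_iff_hasDerivWithinAt hS.map_zero]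
  set I : ℝ → X := fun t => ∫ s in (0 : ℝ)..t, T (t - s : ℝ).toNNReal (L (S s.toNNReal x))
  have hI : HasDerivWithinAt I (L x) (Ioi 0) 0 := by
    have := hasDerivAt_integral_diag (continuous_conv_integrand hT
      (L.continuous.comp ((hS.strongly_continuous x).comp continuous_real_toNNReal)))
    simp only [Function.comp_apply, sub_zero, Real.toNNReal_zero, h.isSemigroup.map_zero,
      hS.map_zero, one_apply_eq_self] at this
    exact this.hasDerivWithinAt
  have e : ∀ t : ℝ, 0 ≤ t → S t.toNNReal x = T t.toNNReal x + I t := by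
    intro t ht
    rw [heq, Real.coe_toNNReal t ht]
  constructor <;> intro hd
  · have := hd.add hI
    rw [sub_add_cancel] at this
    exact this.congr (fun t ht => e t (le_of_lt ht)) (e 0 le_rfl)
  · exact (hd.sub hI).congr (fun t ht => by simp [e t (le_of_lt ht)]) (eq_sub_of_add_eq (e 0 le_rfl).symm)

/-- The operator `γ K + L` generates a semigroup, with a bound uniform in `γ`. -/
theorem exists_generatesSemigroup_damped {K : X →ₗ.[𝕜] X} {E : ℝ≥0 → X →L[𝕜] X}
    (hE : GeneratesSemigroup K E) (hcontr : ∀ t : ℝ≥0, ‖E t‖ ≤ 1) (L : X →L[𝕜] X) {γ : ℝ}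
    (hγ : 0 < γ) : ∃ S : ℝ≥0 → X →L[𝕜] X, GeneratesSemigroup (dampedGenerator K L γ) S ∧
      ∀ t, ‖S t‖ ≤ 2 * Real.exp ((2 * ‖L‖ + 1) * t) := by
  lift γ to ℝ≥0 using hγ.le
  have h := hE.rescale (γ := γ) hγ
  obtain ⟨S, hS, hn, heq⟩ := exists_semigroup_of_contraction h.isSemigroup (fun t => hcontr _) L
  exact ⟨S, h.of_volterra (continuous_uncurry_of_norm_le h.isSemigroup.strongly_continuous
    (N := 1) (ω := 0) fun t => by simpa using hcontr _) hS heq, hn⟩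

end Volterra

/-! ### Strong damping -/

section Damping

open Set MeasureTheory intervalIntegral

variable {𝕜 X : Type*} [RCLike 𝕜] [NormedAddCommGroup X] [NormedSpace 𝕜 X]
  {K : X →ₗ.[𝕜] X} {E : ℝ≥0 → X →L[𝕜] X} {P : X →L[𝕜] X}

theorem IsStronglyContinuousSemigroup.mul_limit (hsg : IsStronglyContinuousSemigroup E)
    (hP : Tendsto E atTop (𝓝 P)) (t : ℝ≥0) : E t * P = P := by
  refine tendsto_nhds_unique (hP.const_mul (E t)) ?_
  exact (hP.comp (tendsto_atTop_mono (fun s => le_add_self) tendsto_id)).congr (hsg.map_add t)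

theorem IsStronglyContinuousSemigroup.limit_mul (hsg : IsStronglyContinuousSemigroup E)
    (hP : Tendsto E atTop (𝓝 P)) (t : ℝ≥0) : P * E t = P := by
  refine tendsto_nhds_unique (hP.mul_const (E t)) ?_
  exact (hP.comp (tendsto_atTop_mono (fun s => le_self_add) tendsto_id)).congr
    fun s => hsg.map_add s t

theorem IsStronglyContinuousSemigroup.limit_mul_self (hsg : IsStronglyContinuousSemigroup E)
    (hP : Tendsto E atTop (𝓝 P)) : P * P = P :=
  tendsto_nhds_unique (hP.mul_const P) (by simp_rw [hsg.mul_limit hP]; exact tendsto_const_nhds)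

/-- Convergence in operator norm is automatically exponential, because `E t - P` is again a
semigroup in `t > 0`. -/
theorem IsStronglyContinuousSemigroup.exists_norm_sub_le_exp
    (hsg : IsStronglyContinuousSemigroup E) (hcontr : ∀ t, ‖E t‖ ≤ 1)
    (hP : Tendsto E atTop (𝓝 P)) :
    ∃ a M : ℝ, 0 < a ∧ 0 ≤ M ∧ ∀ t : ℝ≥0, ‖E t - P‖ ≤ M * Real.exp (-a * t) := by
  have hP1 : ‖P‖ ≤ 1 := le_of_tendsto hP.norm (Eventually.of_forall hcontr)
  obtain ⟨τ, hτ, hτ1⟩ := ((hP.eventually (Metric.closedBall_mem_nhds P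
    (Real.exp_pos (-1)))).and (eventually_ge_atTop 1)).exists
  replace hτ : ‖E τ - P‖ ≤ Real.exp (-1) := by rwa [← dist_eq_norm]
  have hτ0 : (0 : ℝ) < τ := zero_lt_one.trans_le (by exact_mod_cast hτ1)
  -- `(E t - P) (E s - P) = E (t + s) - P`, since `P` is idempotent and absorbs the semigroup.
  have hpow : ∀ (n : ℕ) (r : ℝ≥0), ‖E (n * τ + r) - P‖ ≤ Real.exp (-1) ^ n * 2 := by
    intro n r
    induction n with
    | zero =>
      simpa using (norm_sub_le _ _).trans (add_le_add (hcontr r) hP1) |>.trans_eq (by norm_num)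
    | succ n ih =>
      have e : E ((n + 1 : ℕ) * τ + r) - P = (E τ - P) * (E (n * τ + r) - P) := by
        rw [sub_mul, mul_sub, mul_sub, hsg.mul_limit hP, hsg.limit_mul hP, hsg.limit_mul_self hP,
          ← hsg.map_add]
        have : ((n + 1 : ℕ) : ℝ≥0) * τ + r = τ + (n * τ + r) := by push_cast; ring
        rw [this]; abel
      rw [e, pow_succ', mul_assoc]
      exact (norm_mul_le _ _).trans (mul_le_mul hτ ih (norm_nonneg _) (Real.exp_nonneg _))
  refine ⟨(τ : ℝ)⁻¹, 2 * Real.exp 1, by positivity, by positivity, fun t => ?_⟩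
  -- Write `t = n τ + r` with `n = ⌊t / τ⌋₊`.
  have hle : (⌊t / τ⌋₊ : ℝ≥0) * τ ≤ t := by
    have := Nat.floor_le (zero_le (a := t / τ))
    rwa [le_div_iff₀ (by exact_mod_cast hτ0)] at this
  have h1 := hpow ⌊t / τ⌋₊ (t - ⌊t / τ⌋₊ * τ)
  rw [add_tsub_cancel_of_le hle] at h1
  refine h1.trans ?_
  rw [← Real.exp_nat_mul, mul_comm, mul_assoc, ← Real.exp_add]
  have h2 : (t / τ : ℝ) < ⌊t / τ⌋₊ + 1 := by exact_mod_cast Nat.lt_floor_add_one (t / τ)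
  have h3 : -(τ : ℝ)⁻¹ * t = -(t / τ : ℝ) := by ring
  gcongr
  rw [h3]
  linarith

theorem GeneratesSemigroup.limit_apply_mem_graph (hE : GeneratesSemigroup K E)
    (hP : Tendsto E atTop (𝓝 P)) (x : X) : (P x, 0) ∈ K.graph := by
  rw [hE.mem_graph_iff]
  have : ∀ t, E t (P x) = P x := fun t => by
    rw [← mul_apply_eq_comp, hE.isSemigroup.mul_limit hP]
  simp [this]

variable [NormedSpace ℝ X] [IsScalarTower ℝ 𝕜 X] [CompleteSpace X]
  {S : ℝ≥0 → X →L[𝕜] X} {L : X →L[𝕜] X} {γ a M N : ℝ} {τ : ℝ≥0}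

/-- The semigroup with damping is small on the range of `1 - P`. -/
theorem norm_damped_apply_sub_le (hE : GeneratesSemigroup K E) (hP : Tendsto E atTop (𝓝 P))
    (ha : 0 < a) (hdec : ∀ t : ℝ≥0, ‖E t - P‖ ≤ M * Real.exp (-a * t)) (hγ : 0 < γ)
    (hS : GeneratesSemigroup (dampedGenerator K L γ) S)
    (hSc : Continuous fun p : ℝ≥0 × X => S p.1 p.2) (hN : ∀ t ≤ τ, ‖S t‖ ≤ N) {t : ℝ≥0}
    (ht : t ≤ τ) (x : X) :
    ‖S t (x - P x)‖ ≤ (M * Real.exp (-(a * γ) * t) + N * ‖L‖ * M * (a * γ)⁻¹) * ‖x‖ := by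
  have hN0 : 0 ≤ N := (norm_nonneg _).trans (hN t ht)
  have hclosed : IsClosed {x | ‖S t (x - P x)‖ ≤
      (M * Real.exp (-(a * γ) * t) + N * ‖L‖ * M * (a * γ)⁻¹) * ‖x‖} :=
    isClosed_le (by fun_prop) (by fun_prop)
  -- By density of the domain of `K`, it is enough to treat `x` in that domain.
  refine hclosed.closure_subset_iff.2 ?_ (hE.dense_domain x)
  intro x hx
  lift γ to ℝ≥0 using hγ.le
  have hEγ := hE.rescale (γ := γ) hγ
  obtain ⟨z, hz⟩ : ∃ z, (x - P x, z) ∈ (((γ : ℝ) : 𝕜) • K).graph := by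
    rw [← LinearPMap.mem_domain_iff, LinearPMap.smul_domain]
    exact K.domain.sub_mem hx
      (LinearPMap.mem_domain_of_mem_graph (hE.limit_apply_mem_graph hP x))
  set u : ℝ → X := fun s => E (γ * s.toNNReal) (x - P x)
  have hu : Continuous u :=
    (hEγ.isSemigroup.strongly_continuous (x - P x)).comp continuous_real_toNNReal
  have hun : ∀ s : ℝ, 0 ≤ s → ‖u s‖ ≤ M * Real.exp (-(a * γ) * s) * ‖x‖ := by
    intro s hs
    have e : u s = (E (γ * s.toNNReal) - P) x := by
      simp only [u, map_sub, sub_apply, ← mul_apply_eq_comp, hE.isSemigroup.mul_limit hP]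
    rw [e]
    refine (ContinuousLinearMap.le_of_opNorm_le _ (hdec _) x).trans_eq ?_
    rw [NNReal.coe_mul, Real.coe_toNNReal _ hs]
    ring_nf
  have hduh := hS.sub_eq_integral hSc hu (v := fun s => -(L (u s))) (by fun_prop)
    (fun s hs => ⟨E (γ * s.toNNReal) z + L (u s), by
      rw [dampedGenerator, LinearPMap.mem_graph_vadd_iff, add_sub_cancel_right]
      exact hEγ.apply_mem_graph hz _, by
      simpa only [add_neg_cancel_right] using hEγ.hasDerivWithinAt_apply hz hs⟩) t
  have hint : ‖u t - S t (u 0)‖ ≤ N * ‖L‖ * M * (a * γ)⁻¹ * ‖x‖ := by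
    have hc : Continuous fun s : ℝ => N * ‖L‖ * M * ‖x‖ * Real.exp (-(a * γ) * s) := by fun_prop
    rw [hduh]
    refine (intervalIntegral.norm_integral_le_of_norm_le t.coe_nonneg
      (Eventually.of_forall fun s hs => ?_) (hc.intervalIntegrable _ _)).trans ?_
    · have h1 : ‖S (t - s : ℝ).toNNReal‖ ≤ N := hN _ (le_trans
        (Real.toNNReal_le_iff_le_coe.2 (by linarith [hs.1])) ht)
      calc ‖S (t - s : ℝ).toNNReal (-(L (u s)))‖ ≤ N * ‖-(L (u s))‖ :=
            ContinuousLinearMap.le_of_opNorm_le _ h1 _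
        _ ≤ N * (‖L‖ * (M * Real.exp (-(a * γ) * s) * ‖x‖)) := by
            rw [norm_neg]
            gcongr
            exact (L.le_opNorm _).trans (by gcongr; exact hun s hs.1.le)
        _ = _ := by ring
    · have hM : 0 ≤ M := by simpa using (norm_nonneg _).trans (hdec 0)
      rw [intervalIntegral.integral_const_mul]
      calc _ ≤ N * ‖L‖ * M * ‖x‖ * (a * γ)⁻¹ := by
            gcongr
            exact integral_exp_neg_mul_le (by positivity) _
        _ = _ := by ring
  have hu0 : u 0 = x - P x := by simp [u, hE.isSemigroup.map_zero]
  have hut := hun t t.coe_nonneg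
  rw [hu0] at hint
  calc ‖S t (x - P x)‖ = ‖u t - (u t - S t (x - P x))‖ := by rw [sub_sub_cancel]
    _ ≤ _ := norm_sub_le _ _
    _ ≤ _ := by linarith

/-- On the range of `P`, the damped semigroup follows `exp (t P L P)`; `g` bounds the latter. -/
theorem norm_exp_apply_sub_damped_le (hE : GeneratesSemigroup K E) (hP : Tendsto E atTop (𝓝 P))
    (ha : 0 < a) (hdec : ∀ t : ℝ≥0, ‖E t - P‖ ≤ M * Real.exp (-a * t)) (hγ : 0 < γ)
    (hS : GeneratesSemigroup (dampedGenerator K L γ) S)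
    (hSc : Continuous fun p : ℝ≥0 × X => S p.1 p.2) (hN : ∀ t ≤ τ, ‖S t‖ ≤ N) {g : ℝ}
    (hg : ∀ s ∈ Icc (0 : ℝ) τ, ‖NormedSpace.exp ((s : 𝕜) • (P * L * P)) * P‖ ≤ g) (x : X) :
    ‖(NormedSpace.exp (((τ : ℝ) : 𝕜) • (P * L * P)) * P) x - S τ (P x)‖ ≤
      ‖L‖ * g * (M * (a * γ)⁻¹ + τ * (N * ‖L‖ * M * (a * γ)⁻¹)) * ‖x‖ := by
  set A := P * L * P with hA
  have hPP := hE.isSemigroup.limit_mul_self hP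
  have hM : 0 ≤ M := by simpa using (norm_nonneg _).trans (hdec 0)
  have hN0 : 0 ≤ N := (norm_nonneg _).trans (hN 0 zero_le)
  have hg0 : 0 ≤ g := (norm_nonneg _).trans (hg 0 ⟨le_rfl, τ.coe_nonneg⟩)
  set u : ℝ → X := fun s => NormedSpace.exp ((s : 𝕜) • A) (P x) with hu_def
  have hPu : ∀ s, P (u s) = u s := by
    intro s
    have hcomm : Commute P A := by
      rw [Commute, SemiconjBy, hA, mul_assoc (P * L), hPP, ← mul_assoc, ← mul_assoc, hPP]
    have h1 := ((hcomm.smul_right (s : 𝕜)).exp_right).eq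
    simp only [hu_def, ← mul_apply_eq_comp]
    rw [← mul_assoc, h1, mul_assoc, hPP]
  have hder : ∀ s : ℝ, HasDerivAt u (A (u s)) s := by
    intro s
    have h1 := (hasDerivAt_exp_smul_const' (𝕂 := 𝕜) A (s : 𝕜)).clm_apply
      (hasDerivAt_const (s : 𝕜) (P x))
    have h2 : HasDerivAt u _ s := HasDerivAt.scomp s h1 (RCLike.ofRealCLM (K := 𝕜)).hasDerivAt
    refine h2.congr_deriv ?_
    simp [hu_def]
  have hu : Continuous u := continuous_iff_continuousAt.2 fun s => (hder s).continuousAt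
  have hduh := hS.sub_eq_integral hSc hu (v := fun s => -(L (u s) - P (L (u s)))) (by fun_prop)
    (fun s _ => ⟨L (u s), by
      rw [dampedGenerator, LinearPMap.mem_graph_vadd_iff, sub_self,
        LinearPMap.mem_graph_smul_iff (by exact_mod_cast hγ.ne'), smul_zero, ← hPu s]
      exact hE.limit_apply_mem_graph hP _, by
      have := (hder s).hasDerivWithinAt (s := Ioi s)
      simpa [hA, hPu] using this⟩) τ
  have hu0 : u 0 = P x := by simp [hu_def]
  have huτ : u τ = (NormedSpace.exp (((τ : ℝ) : 𝕜) • A) * P) x := rfl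
  rw [← huτ]
  rw [hu0] at hduh
  rw [hduh]
  have hc : Continuous fun s : ℝ => (M * Real.exp (-(a * γ) * (τ - s)) +
    N * ‖L‖ * M * (a * γ)⁻¹) * (‖L‖ * g * ‖x‖) := by fun_prop
  refine (intervalIntegral.norm_integral_le_of_norm_le τ.coe_nonneg
    (Eventually.of_forall fun s hs => ?_) (hc.intervalIntegrable _ _)).trans ?_
  · rw [map_neg, norm_neg]
    refine (norm_damped_apply_sub_le hE hP ha hdec hγ hS hSc hN
      (Real.toNNReal_le_iff_le_coe.2 (by linarith [hs.1])) _).trans ?_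
    rw [Real.coe_toNNReal _ (sub_nonneg.2 hs.2), mul_assoc ‖L‖]
    gcongr
    exact (L.le_opNorm _).trans (by
      gcongr; exact ContinuousLinearMap.le_of_opNorm_le _ (hg s ⟨hs.1.le, hs.2⟩) x)
  · have hc1 : Continuous fun s : ℝ => M * Real.exp (-(a * γ) * (τ - s)) := by fun_prop
    rw [intervalIntegral.integral_mul_const, intervalIntegral.integral_add
      (hc1.intervalIntegrable _ _) intervalIntegrable_const, intervalIntegral.integral_const_mul,
      intervalIntegral.integral_comp_sub_left (fun s => Real.exp (-(a * γ) * s)),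
      intervalIntegral.integral_const, sub_self, sub_zero, smul_eq_mul]
    calc _ ≤ (M * (a * γ)⁻¹ + τ * (N * ‖L‖ * M * (a * γ)⁻¹)) * (‖L‖ * g * ‖x‖) := by
          gcongr
          exact integral_exp_neg_mul_le (by positivity) _
      _ = _ := by ring

/-- The rate `1 / γ` at a fixed positive time `τ`; the constant blows up as `τ ↓ 0`, because the
initial layer `M exp (-a γ τ)` is estimated by `M / (a γ τ)`. -/
theorem exists_norm_damped_sub_le (hE : GeneratesSemigroup K E)
    (hcontr : ∀ t : ℝ≥0, ‖E t‖ ≤ 1) (hP : Tendsto E atTop (𝓝 P)) (L : X →L[𝕜] X)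
    {S : ℝ → ℝ≥0 → X →L[𝕜] X}
    (hS : ∀ γ : ℝ, 0 < γ → GeneratesSemigroup (dampedGenerator K L γ) (S γ)) (hτ : 0 < τ) :
    ∃ C : ℝ, 0 ≤ C ∧ ∀ γ : ℝ, 0 < γ →
      ‖S γ τ - NormedSpace.exp (((τ : ℝ) : 𝕜) • (P * L * P)) * P‖ ≤ C / γ := by
  obtain ⟨a, M, ha, hM, hdec⟩ := hE.isSemigroup.exists_norm_sub_le_exp hcontr hP
  have hτ' : (0 : ℝ) < τ := hτ
  set N : ℝ := 2 * Real.exp ((2 * ‖L‖ + 1) * τ)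
  have hexp : Continuous fun c : 𝕜 => NormedSpace.exp (c • (P * L * P)) :=
    continuous_iff_continuousAt.2 fun c => (hasDerivAt_exp_smul_const (P * L * P) c).continuousAt
  obtain ⟨g, hg⟩ := isCompact_Icc.exists_bound_of_continuousOn (s := Icc (0 : ℝ) τ)
    (f := fun s : ℝ => NormedSpace.exp ((s : 𝕜) • (P * L * P)) * P)
    ((hexp.comp RCLike.continuous_ofReal).mul continuous_const).continuousOn
  have hg0 : 0 ≤ g := (norm_nonneg _).trans (hg 0 ⟨le_rfl, τ.coe_nonneg⟩)
  refine ⟨M * (a * τ)⁻¹ + N * ‖L‖ * M * a⁻¹ +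
    ‖L‖ * g * (M * a⁻¹ + τ * (N * ‖L‖ * M * a⁻¹)), by positivity, fun γ hγ => ?_⟩
  -- By uniqueness the given semigroup has the bounds of the constructed one.
  obtain ⟨S', hS', hn⟩ := exists_generatesSemigroup_damped hE hcontr L hγ
  have hSc := continuous_uncurry_of_norm_le hS'.isSemigroup.strongly_continuous hn
  rw [hS'.eq hSc (hS γ hγ)]
  have hN : ∀ t ≤ τ, ‖S' t‖ ≤ N := fun t ht => (hn t).trans (by
    have : (t : ℝ) ≤ τ := ht
    simp only [N]; gcongr)
  refine ContinuousLinearMap.opNorm_le_bound _ (by positivity) fun x => ?_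
  have h1 := norm_damped_apply_sub_le hE hP ha hdec hγ hS' hSc hN le_rfl x
  have h2 := norm_exp_apply_sub_damped_le hE hP ha hdec hγ hS' hSc hN hg x
  have h3 : Real.exp (-(a * γ) * τ) ≤ (a * γ * τ)⁻¹ := by
    rw [neg_mul, Real.exp_neg]
    have := Real.add_one_le_exp (a * γ * τ)
    gcongr
    linarith
  calc _ = ‖S' τ (x - P x) -
        ((NormedSpace.exp (((τ : ℝ) : 𝕜) • (P * L * P)) * P) x - S' τ (P x))‖ := by
        rw [map_sub, sub_apply]; congr 1; abel
    _ ≤ _ := norm_sub_le _ _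
    _ ≤ _ := add_le_add h1 h2
    _ ≤ (M * (a * γ * τ)⁻¹ + N * ‖L‖ * M * (a * γ)⁻¹) * ‖x‖ +
        ‖L‖ * g * (M * (a * γ)⁻¹ + τ * (N * ‖L‖ * M * (a * γ)⁻¹)) * ‖x‖ := by gcongr
    _ = _ := by field_simp

end Damping

theorem mainTheorem5 {𝕜 X : Type*} [RCLike 𝕜] [NormedAddCommGroup X] [NormedSpace 𝕜 X]
    [CompleteSpace X] (K : X →ₗ.[𝕜] X) (E : ℝ≥0 → X →L[𝕜] X) (hE : GeneratesSemigroup K E)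
    (hcontr : ∀ t : ℝ≥0, ‖E t‖ ≤ 1) (P : X →L[𝕜] X) (hP : Tendsto E atTop (𝓝 P))
    (L : X →L[𝕜] X) :
    (∀ γ : ℝ, 0 < γ → ∃! S : ℝ≥0 → X →L[𝕜] X, GeneratesSemigroup (dampedGenerator K L γ) S) ∧
    ∀ S : ℝ → ℝ≥0 → X →L[𝕜] X,
      (∀ γ : ℝ, 0 < γ → GeneratesSemigroup (dampedGenerator K L γ) (S γ)) →
      ∀ t : ℝ≥0, 0 < t →
        Tendsto (fun γ : ℝ => S γ t) atTop
          (𝓝 (NormedSpace.exp (((t : ℝ) : 𝕜) • (P * L * P)) * P)) ∧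
        ∃ C : ℝ, 1 ≤ C ∧ ∀ γ : ℝ, 2 ≤ γ →
          ‖S γ t - NormedSpace.exp (((t : ℝ) : 𝕜) • (P * L * P)) * P‖
            ≤ C * Real.log γ / γ := by
  -- Real scalars are needed for the Bochner integral.
  let : NormedSpace ℝ X := NormedSpace.restrictScalars ℝ 𝕜 X
  have : IsScalarTower ℝ 𝕜 X := ⟨fun r c x => by
    rw [RCLike.real_smul_eq_coe_mul, mul_smul]; rfl⟩
  refine ⟨fun γ hγ => ?_, fun S hS t ht => ?_⟩
  · obtain ⟨S, hS, hn⟩ := exists_generatesSemigroup_damped hE hcontr L hγ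
    exact ⟨S, hS, fun T hT =>
      hS.eq (continuous_uncurry_of_norm_le hS.isSemigroup.strongly_continuous hn) hT⟩
  obtain ⟨C, hC, h⟩ := exists_norm_damped_sub_le hE hcontr hP L hS ht
  refine ⟨?_, max 1 (C / Real.log 2), le_max_left _ _, fun γ hγ => ?_⟩
  · refine tendsto_iff_norm_sub_tendsto_zero.2 (squeeze_zero' (Eventually.of_forall fun _ =>
      norm_nonneg _) ?_ (tendsto_const_nhds.div_atTop tendsto_id (a := C)))
    filter_upwards [eventually_gt_atTop 0] with γ hγ using h γ hγ
  · have hγ0 : 0 < γ := by linarith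
    have hl : 0 < Real.log 2 := Real.log_pos (by norm_num)
    refine (h γ hγ0).trans ?_
    gcongr
    calc C = C / Real.log 2 * Real.log 2 := by field_simp
      _ ≤ _ := by
        gcongr
        exact le_max_right _ _
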